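/- Write $\mathcal N=\mathbb N^{\mathbb N}$ for Baire space. A representation of a set $X$ is a partial surjection $\delta_X:\subseteq\mathcal N\to X$. A map $f:X\to Y$ between represented sets is called continuous (respectively Borel measurable) if it has a continuous (respectively Borel measurable) realizer, i.e. a function $F:\operatorname{dom}(\delta_X)\to\operatorname{dom}(\delta_Y)$ that is continuous (respectively Borel measurable) for the subspace topologies and satisfies $\delta_Y(F(p))=f(\delta_X(p))$ for all $p\in\operatorname{dom}(\delta_X)$. A representation $\delta$ of a topological space $X$ is admissible if it is continuous and for every $D\subseteq\mathcal N$ and every continuous $\varphi:D\to X$ there is a continuous $G:D\to\operatorname{dom}(\delta)$ with $\delta\circ G=\varphi$. For $p_0,p_1,\ldots\in\mathcal N$ let $\langle p_0,p_1,\ldots\rangle\in\mathcal N$ be given by $\langle p_0,p_1,\ldots\rangle(\langle n,k\rangle)=p_n(k)$ for the Cantor pairing bijection $\langle\cdot,\cdot\rangle:\mathbb N^2\to\mathbb N$ (or any other fixed bijection), and write $ip$ for the sequence with first entry $i$ followed by $p$. The set of Borel codes is $\mathrm{BC}=\bigcup_{\alpha<\omega_1}\mathrm{BC}_\alpha$,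 where $\mathrm{BC}_0=\{p: p(0)=0\}$ and, for $\alpha>0$, $\mathrm{BC}_\alpha$ is the set of all $1\langle p_0,p_1,\ldots\rangle$ such that every $p_n$ lies in $\mathrm{BC}_\beta$ for some $\beta<\alpha$. The represented space $\mathbf S_{\mathcal B}$ has underlying set $\{\bot,\top\}$ and the representation $\delta_{\mathcal B}$ with domain $\mathrm{BC}$ that is defined recursively by \[ \delta_{\mathcal B}(0p)=\begin{cases}\bot,&p=0^{\mathbb N},\\ \top,&p\ne0^{\mathbb N},\end{cases} \qquad \delta_{\mathcal B}(1\langle p_0,p_1,\ldots\rangle)=\bigvee_{i\in\mathbb N}\neg\,\delta_{\mathcal B}(p_i). \] Proposition. Let $\mathbf X$ be a Polish space, regarded as a represented space through an arbitrary admissible representation. For $A\subseteq\mathbf X$ let $\chi_A:\mathbf X\to\{\bot,\top\}$ be given by $\chi_A(x)=\top\iff x\in A$. Then the following are equivalent: 1. $A$ is a Borel subset of $\mathbf X$; 2. $\chi_A:\mathbf X\to\mathbf S_{\mathcal B}$ is continuous; 3. $\chi_A:\mathbf X\to\mathbf S_{\mathcal B}$ is Borel measurable. -/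

import Mathlib

/-- Baire space `ℕ^ℕ`, with the product topology. -/
abbrev Baire : Type := ℕ → ℕ

namespace Baire

/-- The sequence `q` without its first entry. -/
def tail (q : Baire) : Baire := fun k => q (k + 1)

/-- The `n`-th component `p_n` of `q = ⟨p_0, p_1, …⟩`, where `⟨p_0, p_1, …⟩ (⟨n, k⟩) = p_n k` for
the Cantor pairing bijection `⟨·, ·⟩`; every element of Baire space is of this form. -/
def component (q : Baire) (n : ℕ) : Baire := fun k => q (Nat.pair n k)

end Baire

/-- A representation of a set `X`: a partial surjection from Baire space onto `X`. -/
structure BaireRepresentation (X : Type*) where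
  /-- the set of names -/
  dom : Set Baire
  /-- the point denoted by a name -/
  map : dom → X
  surjective : Function.Surjective map

namespace BaireRepresentation

variable {X Y : Type*}

/-- `F`, a function on the names of points of `X`, realizes `f : X → Y`: it sends
each name of a point `x` to a name of `f x`. -/
def Realizes (δX : BaireRepresentation X) (δY : BaireRepresentation Y) (F : δX.dom → Baire)
    (f : X → Y) : Prop :=
  ∀ p : δX.dom, ∃ h : F p ∈ δY.dom, δY.map ⟨F p, h⟩ = f (δX.map p)

/-- A map between represented spaces is continuous if it has a continuous realizer. -/
def ContinuousMap (δX : BaireRepresentation X) (δY : BaireRepresentation Y) (f : X → Y) : Prop :=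
  ∃ F : δX.dom → Baire, Continuous F ∧ Realizes δX δY F f

/-- A map between represented spaces is Borel measurable if it has a Borel measurable realizer
(the set of names carries the Borel σ-algebra of its subspace topology). -/
def BorelMap (δX : BaireRepresentation X) (δY : BaireRepresentation Y) (f : X → Y) : Prop :=
  ∃ F : δX.dom → Baire,
    @Measurable _ _ (borel δX.dom) (borel Baire) F ∧ Realizes δX δY F f

/-- A representation of a topological space is admissible if it is continuous and every
continuous partial function from Baire space to the space factors through it by a continuous
translation of names. -/
structure IsAdmissible [TopologicalSpace X] (δ : BaireRepresentation X) : Prop where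
  continuous_map : Continuous δ.map
  exists_translation : ∀ (D : Set Baire) (φ : D → X), Continuous φ →
    ∃ G : D → δ.dom, Continuous G ∧ ∀ p, δ.map (G p) = φ p

end BaireRepresentation

/-- The level `BC_α` of the set of Borel codes: `p ∈ BC_0` iff `p 0 = 0`; for `α > 0`,
`p ∈ BC_α` iff `p = 1⟨p_0, p_1, …⟩` and each `p_n` is in `BC_β` for some `β < α`. -/
def BorelCodeLevel (α : Ordinal.{0}) : Set Baire :=
  {p | (α = 0 ∧ p 0 = 0) ∨
    (α ≠ 0 ∧ p 0 = 1 ∧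
      ∀ n, ∃ β, ∃ _ : β < α, p.tail.component n ∈ BorelCodeLevel β)}
termination_by α

/-- The set of Borel codes: the union of the `BC_α` over all countable ordinals `α`. -/
def BorelCode : Set Baire :=
  {p | ∃ α : Ordinal.{0}, α < Ordinal.omega.{0} 1 ∧ p ∈ BorelCodeLevel α}

namespace BorelCode

theorem mem_level_iff {α : Ordinal.{0}} {p : Baire} :
    p ∈ BorelCodeLevel α ↔ (α = 0 ∧ p 0 = 0) ∨
      (α ≠ 0 ∧ p 0 = 1 ∧ ∀ n, ∃ β < α, p.tail.component n ∈ BorelCodeLevel β) := by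
  rw [BorelCodeLevel]
  simp only [Set.mem_ofPred_eq, exists_prop]

theorem of_zero {p : Baire} (h : p 0 = 0) : p ∈ BorelCode :=
  ⟨0, Ordinal.omega_pos 1, mem_level_iff.2 (Or.inl ⟨rfl, h⟩)⟩

theorem component_mem {p : Baire} (hp : p ∈ BorelCode) (h : p 0 = 1) (n : ℕ) :
    p.tail.component n ∈ BorelCode := by
  obtain ⟨α, hα, hp⟩ := hp
  rcases mem_level_iff.1 hp with ⟨_, h0⟩ | ⟨_, _, hn⟩
  · omega
  · obtain ⟨β, hβ, hq⟩ := hn n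
    exact ⟨β, hβ.trans hα, hq⟩

/-- `q` is one of the codes `p_n` when `p = 1⟨p_0, p_1, …⟩`. -/
def Sub (q p : BorelCode) : Prop :=
  p.1 0 = 1 ∧ ∃ n, q.1 = p.1.tail.component n

theorem wellFounded_sub : WellFounded Sub := by
  have key : ∀ α : Ordinal.{0}, ∀ p : BorelCode, p.1 ∈ BorelCodeLevel α → Acc Sub p := by
    intro α
    induction α using WellFoundedLT.induction with
    | ind α ih =>
      intro p hp
      refine ⟨_, fun q hq => ?_⟩
      obtain ⟨h1, n, hn⟩ := hq
      rcases mem_level_iff.1 hp with ⟨_, h0⟩ | ⟨_, _, hl⟩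
      · omega
      · obtain ⟨β, hβ, hm⟩ := hl n
        exact ih β hβ q (hn ▸ hm)
  exact ⟨fun p => p.2.elim fun α h => key α p h.2⟩

/-- The truth value denoted by a code, with `⊤ = True` and `⊥ = False`, by recursion along
subcodes: `0p` denotes `⊤` iff `p ≠ 0^ℕ`, and `1⟨p_0, p_1, …⟩` denotes the
disjunction of the negations of the values of the `p_n`. -/
noncomputable def value : BorelCode → Prop :=
  wellFounded_sub.fix fun p v =>
    (p.1 0 = 0 ∧ p.1.tail ≠ 0) ∨
      ∃ h : p.1 0 = 1, ∃ n,
        ¬ v ⟨p.1.tail.component n, component_mem p.2 h n⟩ ⟨h, n, rfl⟩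

theorem value_of_zero (p : BorelCode) (h : p.1 0 = 0) :
    value p ↔ p.1.tail ≠ 0 := by
  rw [value, WellFounded.fix_eq]
  simp [h]

theorem value_of_one (p : BorelCode) (h : p.1 0 = 1) :
    value p ↔ ∃ n, ¬ value ⟨p.1.tail.component n, component_mem p.2 h n⟩ := by
  conv_lhs => rw [value, WellFounded.fix_eq]
  simp [h, value]

theorem value_surjective : Function.Surjective value := by
  intro b
  by_cases hb : b
  · refine ⟨⟨fun k => k, of_zero rfl⟩, ?_⟩
    rw [eq_iff_iff, value_of_zero _ rfl, iff_true_right hb]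
    exact fun h => absurd (congrFun h 0) (by simp [Baire.tail])
  · refine ⟨⟨fun _ => 0, of_zero rfl⟩, ?_⟩
    rw [eq_iff_iff, value_of_zero _ rfl, iff_false_right hb]
    exact fun h => h rfl

end BorelCode

/-- The Sierpiński-like represented space `S_B`: its underlying set is
`{⊥, ⊤} = {False, True} = Prop`, its names are the Borel codes. -/
noncomputable def sierpinskiBorel : BaireRepresentation Prop where
  dom := BorelCode
  map := BorelCode.value
  surjective := BorelCode.value_surjective

/-- The characteristic function of `A`, with values in `{⊥, ⊤} = Prop`. -/
def chi {X : Type*} (A : Set X) : X → Prop := fun x => x ∈ A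

/-! From 1 to 2: the preimage of a Borel set under `δ.map` is the trace on `δ.dom` of a Borel set of
Baire space. Sets whose membership can be coded continuously include the open sets and are closed
under countable unions of complements, hence include all Borel sets
(`ContinuouslyCoded.of_measurableSet`).

From 3 to 1: admissibility lifts a continuous surjection from Baire space onto `X` to names, so a
Borel realizer becomes a Borel map `H` on all of Baire space. Decoding proceeds by transfinite
recursion, but the value of one code is witnessed by a truth labeling of its countable tree of
subcodes. Being a labeling is a Borel condition; on a genuine code a labeling exists and its root
label is forced by well-foundedness. Thus `A` and its complement are both analytic, and Suslin's
theorem makes `A` Borel. -/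

open Set MeasureTheory

namespace Baire

/-- The sequence with first entry `i` followed by `p`. -/
def cons (i : ℕ) (p : Baire) : Baire := fun k => Nat.casesOn k i p

@[simp] theorem cons_zero (i : ℕ) (p : Baire) : cons i p 0 = i := rfl

@[simp] theorem tail_cons (i : ℕ) (p : Baire) : (cons i p).tail = p := rfl

/-- The sequence `⟨p_0, p_1, …⟩`. -/
def join (p : ℕ → Baire) : Baire := fun k => p k.unpair.1 k.unpair.2

@[simp] theorem component_join (p : ℕ → Baire) (n : ℕ) : (join p).component n = p n := by
  funext k
  simp [component, join]

theorem continuous_cons_comp {Z : Type*} [TopologicalSpace Z] (i : ℕ) {f : Z → Baire}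
    (hf : Continuous f) : Continuous fun z => cons i (f z) := by
  refine continuous_pi fun k => ?_
  cases k with
  | zero => exact continuous_const
  | succ k => exact (continuous_apply k).comp hf

theorem continuous_join_comp {Z : Type*} [TopologicalSpace Z] {f : ℕ → Z → Baire}
    (hf : ∀ n, Continuous (f n)) : Continuous fun z => join fun n => f n z :=
  continuous_pi fun k => (continuous_apply k.unpair.2).comp (hf k.unpair.1)

end Baire

/-! ### Continuous coding of Borel sets -/

namespace BorelCode

theorem cons_one_join_mem {p : ℕ → Baire} (hp : ∀ n, p n ∈ BorelCode) :
    Baire.cons 1 (Baire.join p) ∈ BorelCode := by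
  choose β hβ hpβ using hp
  -- Successors put the supremum strictly above every `β n`; a countable supremum of countable
  -- ordinals stays below `ω₁`.
  have hlt : (⨆ n, Order.succ (β n)) < Ordinal.omega 1 :=
    Ordinal.iSup_lt_omega_one fun n =>
      (Cardinal.isSuccLimit_omega 1).succ_lt (hβ n)
  have hle : ∀ n, β n < ⨆ n, Order.succ (β n) := fun n =>
    (Order.lt_succ (β n)).trans_le (Ordinal.le_iSup (fun n => Order.succ (β n)) n)
  refine ⟨_, hlt, mem_level_iff.2 (Or.inr ⟨(pos_of_gt (hle 0)).ne', rfl, fun n => ?_⟩)⟩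
  exact ⟨β n, hle n, by simpa using hpβ n⟩

theorem value_cons_one_join {p : ℕ → Baire} (hp : ∀ n, p n ∈ BorelCode) :
    value ⟨_, cons_one_join_mem hp⟩ ↔ ∃ n, ¬ value ⟨p n, hp n⟩ := by
  rw [value_of_one _ (Baire.cons_zero 1 (Baire.join p))]
  simp

/-- A set of points of Baire space is coded continuously if some continuous function maps each point
to a Borel code of the truth value of its membership. -/
def ContinuouslyCoded (B : Set Baire) : Prop :=
  ∃ F : Baire → Baire, Continuous F ∧ ∀ p, ∃ h : F p ∈ BorelCode, value ⟨F p, h⟩ ↔ p ∈ B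

theorem ContinuouslyCoded.iUnion_compl {B : ℕ → Set Baire} (hB : ∀ n, ContinuouslyCoded (B n)) :
    ContinuouslyCoded (⋃ n, (B n)ᶜ) := by
  choose F hF hmem hval using hB
  refine ⟨fun p => Baire.cons 1 (Baire.join fun n => F n p),
    Baire.continuous_cons_comp 1 (Baire.continuous_join_comp hF), fun p =>
    ⟨cons_one_join_mem fun n => hmem n p, ?_⟩⟩
  rw [value_cons_one_join fun n => hmem n p]
  simp [hval]

theorem ContinuouslyCoded.compl {B : Set Baire} (hB : ContinuouslyCoded B) :
    ContinuouslyCoded Bᶜ := by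
  simpa only [iUnion_const] using ContinuouslyCoded.iUnion_compl fun _ : ℕ => hB

theorem ContinuouslyCoded.of_isOpen {U : Set Baire} (hU : IsOpen U) : ContinuouslyCoded U := by
  classical
  refine ⟨fun p => Baire.cons 0 fun k => if PiNat.cylinder p k ⊆ U then 1 else 0,
    Baire.continuous_cons_comp 0 (continuous_pi fun k => ?_), fun p => ⟨of_zero rfl, ?_⟩⟩
  -- Digit `k` depends only on the first `k` entries of `p`.
  · refine IsLocallyConstant.continuous ((IsLocallyConstant.iff_exists_open _).2 fun p =>
      ⟨PiNat.cylinder p k, PiNat.isOpen_cylinder _ p k, PiNat.self_mem_cylinder p k,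
        fun q hq => ?_⟩)
    rw [PiNat.mem_cylinder_iff_eq.1 hq]
  · rw [value_of_zero _ rfl, Baire.tail_cons, Function.ne_iff]
    constructor
    · rintro ⟨k, hk⟩
      have : PiNat.cylinder p k ⊆ U := by
        by_contra h
        simp [h] at hk
      exact this (PiNat.self_mem_cylinder p k)
    · intro hp
      obtain ⟨k, hk⟩ : ∃ k, PiNat.cylinder p k ⊆ U := by
        obtain ⟨_, ⟨x, k, rfl⟩, hpx, hsub⟩ :=
          (PiNat.isTopologicalBasis_cylinders _).exists_subset_of_mem_open hp hU
        exact ⟨k, (PiNat.mem_cylinder_iff_eq.1 hpx).symm ▸ hsub⟩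
      exact ⟨k, by simp [hk]⟩

theorem ContinuouslyCoded.of_measurableSet {B : Set Baire} (hB : MeasurableSet B) :
    ContinuouslyCoded B := by
  induction B, hB using MeasurableSet.induction_on_open with
  | isOpen U hU => exact .of_isOpen hU
  | compl B _ ih => exact ih.compl
  | iUnion f _ _ ih => simpa using ContinuouslyCoded.iUnion_compl fun n => (ih n).compl

/-! ### Labelings of the tree of subcodes -/

open Classical in
/-- The `n`-th immediate subcode of `p`, where a code of level `0` counts as its own subcode. -/
noncomputable def child (p : Baire) (n : ℕ) : Baire :=
  if p 0 = 1 then p.tail.component n else p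

theorem child_mem {p : Baire} (hp : p ∈ BorelCode) (n : ℕ) : child p n ∈ BorelCode := by
  unfold child
  split_ifs with h
  · exact component_mem hp h n
  · exact hp

/-- The iterated subcode of `p` reached along the list `s`, which is read from its end. -/
noncomputable def descendant (p : Baire) (s : List ℕ) : Baire :=
  s.foldr (fun n q => child q n) p

@[simp] theorem descendant_nil (p : Baire) : descendant p [] = p := rfl

@[simp] theorem descendant_cons (p : Baire) (n : ℕ) (s : List ℕ) :
    descendant p (n :: s) = child (descendant p s) n := rfl

theorem descendant_mem {p : Baire} (hp : p ∈ BorelCode) (s : List ℕ) :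
    descendant p s ∈ BorelCode := by
  induction s with
  | nil => exact hp
  | cons n s ih => exact child_mem ih n

theorem measurable_child (n : ℕ) : Measurable fun p : Baire => child p n := by
  unfold child
  refine Measurable.ite ((measurable_pi_apply 0) (measurableSet_singleton 1))
    (measurable_pi_lambda _ fun k => ?_) measurable_id
  exact measurable_pi_apply _

theorem measurable_descendant (s : List ℕ) : Measurable fun p : Baire => descendant p s := by
  induction s with
  | nil => exact measurable_id
  | cons n s ih => exact (measurable_child n).comp ih

/-- A labeling of the tree of iterated subcodes of `p` by truth values that obeys the recursive
rules for the value of a Borel code. -/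
def IsLabeling (p : Baire) (v : List ℕ → Bool) : Prop :=
  ∀ s, (descendant p s 0 = 0 → (v s = true ↔ ∃ k, descendant p s (k + 1) ≠ 0)) ∧
    (descendant p s 0 = 1 → (v s = true ↔ ∃ n, v (n :: s) = false))

theorem value_iff_of_apply_zero {p : Baire} (hp : p ∈ BorelCode) (h : p 0 = 0) :
    value ⟨p, hp⟩ ↔ ∃ k, p (k + 1) ≠ 0 := by
  rw [value_of_zero _ h, Function.ne_iff]
  rfl

theorem value_iff_of_apply_one {p : Baire} (hp : p ∈ BorelCode) (h : p 0 = 1) :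
    value ⟨p, hp⟩ ↔ ∃ n, ¬ value ⟨child p n, child_mem hp n⟩ := by
  rw [value_of_one _ h]
  simp only [child, if_pos h]

theorem exists_isLabeling {p : Baire} (hp : p ∈ BorelCode) : ∃ v, IsLabeling p v := by
  classical
  refine ⟨fun s => decide (value ⟨descendant p s, descendant_mem hp s⟩), fun s => ⟨fun h => ?_,
    fun h => ?_⟩⟩
  · simpa using value_iff_of_apply_zero (descendant_mem hp s) h
  · simp only [decide_eq_true_iff, decide_eq_false_iff_not]
    exact value_iff_of_apply_one (descendant_mem hp s) h

/-- Well-founded induction on subcodes, over all positions `s` at once, since the rule at `s` refers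
to the labels at `n :: s`. -/
theorem IsLabeling.eq_true_iff {p : Baire} {v : List ℕ → Bool} (hv : IsLabeling p v)
    (hp : p ∈ BorelCode) : v [] = true ↔ value ⟨p, hp⟩ := by
  suffices H : ∀ q : BorelCode, ∀ s, q.1 = descendant p s → (v s = true ↔ value q) from
    H ⟨p, hp⟩ [] rfl
  intro q
  induction q using wellFounded_sub.induction with
  | _ q ih =>
    obtain ⟨q, hq⟩ := q
    rintro s rfl
    have h01 : descendant p s 0 = 0 ∨ descendant p s 0 = 1 := by
      obtain ⟨α, -, h⟩ := hq
      exact (mem_level_iff.1 h).imp And.right fun h => h.2.1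
    rcases h01 with h | h
    · rw [(hv s).1 h, value_iff_of_apply_zero hq h]
    · rw [(hv s).2 h, value_iff_of_apply_one hq h]
      refine exists_congr fun n => ?_
      rw [← ih ⟨child (descendant p s) n, child_mem hq n⟩ ⟨h, n, if_pos h⟩ (n :: s) rfl,
        Bool.not_eq_true]

/-- The rules range over countably many positions, digits and children, and each atomic condition is
Borel. -/
theorem measurableSet_isLabeling :
    MeasurableSet {x : Baire × (List ℕ → Bool) | IsLabeling x.1 x.2} := by
  have hd : ∀ s k i, MeasurableSet {x : Baire × (List ℕ → Bool) | descendant x.1 s k = i} :=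
    fun s k i => ((measurable_pi_apply k).comp
      ((measurable_descendant s).comp measurable_fst)) (measurableSet_singleton i)
  have hv : ∀ s b, MeasurableSet {x : Baire × (List ℕ → Bool) | x.2 s = b} := fun s b =>
    measurableSet_eq_fun ((measurable_pi_apply s).comp measurable_snd) measurable_const
  have hiff : ∀ {P Q : Baire × (List ℕ → Bool) → Prop}, MeasurableSet {x | P x} →
      MeasurableSet {x | Q x} → MeasurableSet {x | P x ↔ Q x} := fun hP hQ => hP.iff hQ
  have himp : ∀ {P Q : Baire × (List ℕ → Bool) → Prop}, MeasurableSet {x | P x} →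
      MeasurableSet {x | Q x} → MeasurableSet {x | P x → Q x} := fun hP hQ => hP.imp hQ
  simp only [IsLabeling, ofPred_forall]
  refine MeasurableSet.iInter fun s => MeasurableSet.inter
    (himp (hd s 0 0) (hiff (hv s true) ?_)) (himp (hd s 0 1) (hiff (hv s true) ?_))
  · rw [ofPred_exists]
    exact MeasurableSet.iUnion fun k => (hd s (k + 1) 0).compl
  · rw [ofPred_exists]
    exact MeasurableSet.iUnion fun n => hv (n :: s) false

theorem measurableSet_of_value_comp {X : Type*} [TopologicalSpace X] [PolishSpace X]
    [MeasurableSpace X] [BorelSpace X] {φ : Baire → X} (hφ : Continuous φ)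
    (hsurj : Function.Surjective φ) {H : Baire → Baire} (hH : Measurable H) {A : Set X}
    (hA : ∀ p, ∃ h : H p ∈ BorelCode, value ⟨H p, h⟩ ↔ φ p ∈ A) : MeasurableSet A := by
  choose hmem hval using hA
  have : PolishSpace (Baire × (List ℕ → Bool)) := ⟨⟩
  let S (b : Bool) : Set (Baire × (List ℕ → Bool)) :=
    {x | IsLabeling (H x.1) x.2 ∧ x.2 [] = b}
  have hS : ∀ b, AnalyticSet ((fun x : Baire × (List ℕ → Bool) => φ x.1) '' S b) := by
    intro b
    have h1 : MeasurableSet {x : Baire × (List ℕ → Bool) | IsLabeling (H x.1) x.2} :=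
      ((hH.comp measurable_fst).prodMk measurable_snd) measurableSet_isLabeling
    have h2 : MeasurableSet {x : Baire × (List ℕ → Bool) | x.2 [] = b} :=
      measurableSet_eq_fun ((measurable_pi_apply []).comp measurable_snd) measurable_const
    exact (h1.inter h2).analyticSet.image_of_continuous (hφ.comp continuous_fst)
  -- The projection of `S true` is `A` and that of `S false` is its complement: one inclusion uses
  -- uniqueness of the root label, the other existence of a labeling.
  have key : ∀ (b : Bool) (x : X),
      x ∈ (fun x : Baire × (List ℕ → Bool) => φ x.1) '' S b ↔ (b = true ↔ x ∈ A) := by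
    intro b x
    constructor
    · rintro ⟨⟨p, v⟩, ⟨hv, rfl⟩, rfl⟩
      rw [← hval p]
      exact hv.eq_true_iff (hmem p)
    · intro hb
      obtain ⟨p, rfl⟩ := hsurj x
      obtain ⟨v, hv⟩ := exists_isLabeling (hmem p)
      refine ⟨(p, v), ⟨hv, ?_⟩, rfl⟩
      rw [Bool.eq_iff_iff, hb, ← hval p]
      exact hv.eq_true_iff (hmem p)
  refine AnalyticSet.measurableSet_of_compl ?_ ?_
  · convert hS true using 1
    ext x
    simp [key true x]
  · convert hS false using 1
    ext x
    simp [key false x]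

end BorelCode

/-! ### The implications between the three conditions -/

namespace BaireRepresentation

theorem continuousMap_chi_of_measurableSet {X : Type*} [TopologicalSpace X] [MeasurableSpace X]
    [BorelSpace X] {δ : BaireRepresentation X} (hδ : Continuous δ.map) {A : Set X}
    (hA : MeasurableSet A) : δ.ContinuousMap sierpinskiBorel (chi A) := by
  obtain ⟨B, hB, hBA⟩ := hδ.measurable hA
  obtain ⟨F, hF, h⟩ := BorelCode.ContinuouslyCoded.of_measurableSet hB
  refine ⟨fun p => F p, hF.comp continuous_subtype_val, fun p => ?_⟩
  obtain ⟨hmem, hval⟩ := h p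
  refine ⟨hmem, propext (hval.trans ?_)⟩
  exact Set.ext_iff.1 hBA p

theorem ContinuousMap.borelMap {X Y : Type*} {δX : BaireRepresentation X}
    {δY : BaireRepresentation Y} {f : X → Y} (h : δX.ContinuousMap δY f) : δX.BorelMap δY f := by
  obtain ⟨F, hF, hr⟩ := h
  exact ⟨F, hF.borel_measurable, hr⟩

theorem measurableSet_of_borelMap_chi {X : Type*} [TopologicalSpace X] [PolishSpace X]
    [MeasurableSpace X] [BorelSpace X] {δ : BaireRepresentation X} (hδ : δ.IsAdmissible)
    {A : Set X} (hA : δ.BorelMap sierpinskiBorel (chi A)) : MeasurableSet A := by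
  obtain ⟨F, hF, hr⟩ := hA
  cases isEmpty_or_nonempty X with
  | inl _ => exact (Set.eq_empty_of_isEmpty A) ▸ MeasurableSet.empty
  | inr _ =>
    obtain ⟨φ, hφ, hsurj⟩ := PolishSpace.exists_nat_nat_continuous_surjective X
    -- Passing through `G` moves the problem from `δ.dom`, which may be an arbitrary set, to all of
    -- Baire space.
    obtain ⟨G, hG, hGφ⟩ := hδ.exists_translation univ (fun p => φ p)
      (hφ.comp continuous_subtype_val)
    rw [← BorelSpace.measurable_eq (α := Baire), ← BorelSpace.measurable_eq (α := δ.dom)] at hF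
    have hG' : Continuous fun p : Baire => G ⟨p, mem_univ p⟩ := by fun_prop
    refine BorelCode.measurableSet_of_value_comp hφ hsurj
      (H := fun p => F (G ⟨p, mem_univ p⟩)) (hF.comp hG'.measurable) fun p => ?_
    obtain ⟨hmem, hval⟩ := hr (G ⟨p, mem_univ p⟩)
    refine ⟨hmem, (Eq.to_iff hval).trans ?_⟩
    rw [hGφ]
    rfl

end BaireRepresentation

/-- Let `X` be a Polish space, made into a represented space by an admissible representation `δ`.
A set is Borel iff its characteristic function into `S_B` is continuous iff the latter is Borel
measurable. -/
theorem proposition39 {X : Type*} [TopologicalSpace X] [PolishSpace X]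
    (δ : BaireRepresentation X) (hδ : δ.IsAdmissible) (A : Set X) :
    [@MeasurableSet X (borel X) A,
      δ.ContinuousMap sierpinskiBorel (chi A),
      δ.BorelMap sierpinskiBorel (chi A)].TFAE := by
  borelize X
  tfae_have 1 → 2 := BaireRepresentation.continuousMap_chi_of_measurableSet hδ.continuous_map
  tfae_have 2 → 3 := BaireRepresentation.ContinuousMap.borelMap
  tfae_have 3 → 1 := BaireRepresentation.measurableSet_of_borelMap_chi hδ
  tfae_finish
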